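/- Let $b_0\le b_1\le b_2\le\cdots$ be a nondecreasing sequence of nonnegative integers (the barrier), fix $p\in(0,1)$ and put $q:=1-p$. For $n\ge 0$ and each sequence of integers $a=(a_0,\dots,a_n)$ of length $n+1$ with $0\le a_0\le a_1\le\cdots\le a_n$ and $a_i\le b_i$ for all $0\le i\le n$, define the weight $$w(a):=\frac{p^{n+1}\,q^{\,b_{n+1}+1}}{1-q^{\,1+b_0}}.$$ Consider the lattice walk that makes independent steps, each to the right with probability $p$ and upward with probability $q$, and say that it hits the barrier if at some time it has made exactly $i$ steps to the right (for some $i\ge 0$) and more than $b_i$ upward steps. Then, all sums being over all $n\ge 0$ and all such sequences $a$ of length $n+1$, the series $\sum_a w(a)$ converges, its sum is the conditional probability that the walk hits the barrier given that its first $b_0+1$ steps are not all upward, and $$\sum_a w(a)\le 1 .$$ Furthermore, let $\theta:=\liminf_{n\to\infty} b_n/n\in[0,\infty]$. 1. If $\theta<q/p$, then $\sum_a w(a)=1$. 2. If $\theta=q/p$ and $|b_n-\theta n|=O(\sqrt n)$ as $n\to\infty$, then $\sum_a w(a)=1$. 3. If $\theta>q/p$, then $\sum_a w(a)\ne 1$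 (so $\sum_a w(a)<1$). -/

import Mathlib

open MeasureTheory ProbabilityTheory Filter Asymptotics
open scoped ENNReal unitInterval

/-- The finite nonempty nondecreasing sequences `0 ≤ a 0 ≤ ⋯ ≤ a n` of integers lying below the
barrier `b`; the component `n` is one less than the length of the sequence. -/
abbrev SeqBelow (b : ℕ → ℕ) : Type :=
  Σ n : ℕ, {a : Fin (n + 1) → ℕ // Monotone a ∧ ∀ i, a i ≤ b i}

/-- The weight `p ^ (n + 1) * q ^ (b (n + 1) + 1) / (1 - q ^ (1 + b 0))`, where `q = 1 - p`, of a
sequence of length `n + 1` below the barrier. -/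
noncomputable def weight (b : ℕ → ℕ) (p : ℝ) (a : SeqBelow b) : ℝ :=
  p ^ (a.1 + 1) * (1 - p) ^ (b (a.1 + 1) + 1) / (1 - (1 - p) ^ (1 + b 0))

/-- The lower slope `liminf b n / n` of the barrier, in `[0, ∞]`. -/
noncomputable def lowerSlope (b : ℕ → ℕ) : ℝ≥0∞ :=
  liminf (fun n : ℕ => (b n : ℝ≥0∞) / (n : ℝ≥0∞)) atTop

/-- The law of an infinite sequence of independent steps, each of them to the right (`false`) with
probability `p` and upward (`true`) with probability `1 - p`. -/
noncomputable def walkLaw (p : I) : Measure (ℕ → Bool) :=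
  Measure.infinitePi fun _ : ℕ => bernoulliMeasure false true p

/-- The number of upward steps among the first `n` steps. -/
def upSteps (ω : ℕ → Bool) (n : ℕ) : ℕ :=
  ((Finset.range n).filter fun k => ω k = true).card

/-- The number of steps to the right among the first `n` steps. -/
def rightSteps (ω : ℕ → Bool) (n : ℕ) : ℕ :=
  ((Finset.range n).filter fun k => ω k = false).card

/-- The event that the walk collides with the barrier: at some time, when it has made `i` steps to
the right, it has made more than `b i` upward steps. -/
def hitsBarrier (b : ℕ → ℕ) : Set (ℕ → Bool) :=
  {ω | ∃ n, b (rightSteps ω n) < upSteps ω n}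

/-- The event that the walk steps to the right before it collides with the barrier, that is, that
its first `b 0 + 1` steps are not all upward. -/
def stepsRight (b : ℕ → ℕ) : Set (ℕ → Bool) :=
  {ω | ∃ k ≤ b 0, ω k = false}

/-! ### Counting steps, and measurability of the two events. -/

section Counts

variable (b : ℕ → ℕ) (ω : ℕ → Bool)

/-! Cut a walk at its first collision. If it has stepped right before, the heights `a i` at which it
leaves columns `0, …, n` form a sequence below the barrier, and the cut is at height `b (n + 1) + 1`
in column `n + 1`. This is a bijection, so the cylinders `a.walks` partition `stepsRight b ∩
hitsBarrier b`. A cylinder has probability `p ^ (n + 1) * q ^ (b (n + 1) + 1)`, and dividing by the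
probability of `stepsRight b` gives the weight (`hasSum_weight`).

What remains is whether the walk hits the barrier almost surely. By the strong law its slope tends
to `q / p`. A smaller lower slope therefore forces a collision in some far column. With a larger
one, the walk stays below some raised line of intermediate slope with positive probability, and an
initial run of steps to the right makes room for the raise.

In the critical case a walk that never collides exceeds its mean height by at most `C * √n + M`. By
the central limit theorem it breaks any such bound at a suitable time with probability above a fixed
`δ`. Restarting there shows that the supremum `s` over `M` of the probabilities of such bounds
satisfies `s ≤ (1 - δ) * s`, so `s = 0` (`walkLaw_boundedDeviation`). -/

lemma upSteps_succ (n : ℕ) : upSteps ω (n + 1) = upSteps ω n + if ω n = true then 1 else 0 := by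
  simp only [upSteps, Finset.card_filter, Finset.sum_range_succ]

lemma rightSteps_succ (n : ℕ) :
    rightSteps ω (n + 1) = rightSteps ω n + if ω n = false then 1 else 0 := by
  simp only [rightSteps, Finset.card_filter, Finset.sum_range_succ]

lemma upSteps_add_rightSteps (n : ℕ) : upSteps ω n + rightSteps ω n = n := by
  induction n with
  | zero => simp [upSteps, rightSteps]
  | succ n ih => rw [upSteps_succ, rightSteps_succ]; cases ω n <;> simp <;> omega

lemma upSteps_mono : Monotone (upSteps ω) :=
  monotone_nat_of_le_succ fun n => by rw [upSteps_succ]; omega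

lemma rightSteps_mono : Monotone (rightSteps ω) :=
  monotone_nat_of_le_succ fun n => by rw [rightSteps_succ]; omega

lemma upSteps_add (l n : ℕ) :
    upSteps ω (l + n) = upSteps ω l + upSteps (fun k => ω (k + l)) n := by
  induction n with
  | zero => simp [upSteps]
  | succ n ih => rw [← add_assoc, upSteps_succ, upSteps_succ, ih, add_comm l n, add_assoc]

lemma rightSteps_add (l n : ℕ) :
    rightSteps ω (l + n) = rightSteps ω l + rightSteps (fun k => ω (k + l)) n := by
  induction n with
  | zero => simp [rightSteps]
  | succ n ih => rw [← add_assoc, rightSteps_succ, rightSteps_succ, ih, add_comm l n, add_assoc]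

/-- A walk which makes at least `i` steps to the right has exactly `i` of them at some time. -/
lemma exists_rightSteps_eq {i m : ℕ} (h : i ≤ rightSteps ω m) : ∃ n, rightSteps ω n = i := by
  induction m with
  | zero => exact ⟨0, by simp [rightSteps] at h ⊢; omega⟩
  | succ m ih =>
    by_cases hm : i ≤ rightSteps ω m
    · exact ih hm
    · refine ⟨m + 1, le_antisymm ?_ h⟩
      rw [rightSteps_succ]
      split_ifs <;> omega

lemma measurable_upSteps (n : ℕ) : Measurable fun ω => upSteps ω n := by
  simp only [upSteps, Finset.card_filter]
  refine Finset.measurable_fun_sum _ fun k _ => ?_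
  exact (measurable_from_top (f := fun x : Bool => if x = true then 1 else 0)).comp
    (measurable_pi_apply k)

lemma measurable_rightSteps (n : ℕ) : Measurable fun ω => rightSteps ω n := by
  simp only [rightSteps, Finset.card_filter]
  refine Finset.measurable_fun_sum _ fun k _ => ?_
  exact (measurable_from_top (f := fun x : Bool => if x = false then 1 else 0)).comp
    (measurable_pi_apply k)

lemma measurableSet_hitsBarrier : MeasurableSet (hitsBarrier b) := by
  have : hitsBarrier b = ⋃ n, {ω | b (rightSteps ω n) < upSteps ω n} := by
    ext; simp [hitsBarrier]
  rw [this]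
  exact .iUnion fun n => measurableSet_lt
    ((measurable_from_top (f := b)).comp (measurable_rightSteps n)) (measurable_upSteps n)

lemma measurableSet_stepsRight : MeasurableSet (stepsRight b) := by
  have : stepsRight b = ⋃ k ∈ Set.Iic (b 0), (fun ω : ℕ → Bool => ω k) ⁻¹' {false} := by
    ext; simp [stepsRight]
  rw [this]
  exact .biUnion (Set.to_countable _) fun k _ => measurable_pi_apply k (.singleton _)

end Counts

/-! ### Bijection between sequences and paths to the first collision. -/

section Paths

variable {b : ℕ → ℕ}

/-- The number of steps of the walk to the first collision encoded by `a`. -/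
def SeqBelow.length (a : SeqBelow b) : ℕ := b (a.1 + 1) + 1 + (a.1 + 1)

/-- The times of the steps to the right of the walk encoded by `a`. -/
def SeqBelow.rightTimes (a : SeqBelow b) : Finset ℕ :=
  Finset.univ.image fun i : Fin (a.1 + 1) => a.2.1 i + i

/-- The walks which begin with the path encoded by `a`: it steps to the right from column `i` at
height `a i` and collides with the barrier in the column after the last one. -/
def SeqBelow.walks (a : SeqBelow b) : Set (ℕ → Bool) :=
  {ω | ∀ k < a.length, ω k = false ↔ k ∈ a.rightTimes}

lemma SeqBelow.strictMono_add (a : SeqBelow b) :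
    StrictMono fun i : Fin (a.1 + 1) => a.2.1 i + (i : ℕ) :=
  a.2.2.1.add_strictMono fun _ _ h => h

lemma SeqBelow.card_rightTimes (a : SeqBelow b) : a.rightTimes.card = a.1 + 1 := by
  rw [rightTimes, Finset.card_image_of_injective _ a.strictMono_add.injective]
  simp

lemma SeqBelow.lt_length (hb : Monotone b) (a : SeqBelow b) {k : ℕ} (hk : k ∈ a.rightTimes) :
    k < a.length := by
  simp only [rightTimes, Finset.mem_image, Finset.mem_univ, true_and] at hk
  obtain ⟨i, rfl⟩ := hk
  have h1 := a.2.2.2 i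
  have h2 : b i ≤ b (a.1 + 1) := hb (by omega)
  simp only [length]
  omega

lemma SeqBelow.filter_eq (hb : Monotone b) {a : SeqBelow b} {ω : ℕ → Bool} (h : ω ∈ a.walks) :
    (Finset.range a.length).filter (fun k => ω k = false) = a.rightTimes := by
  ext k
  simp only [Finset.mem_filter, Finset.mem_range]
  exact ⟨fun hk => (h k hk.1).1 hk.2, fun hk => ⟨a.lt_length hb hk, (h k (a.lt_length hb hk)).2 hk⟩⟩

lemma SeqBelow.rightSteps_length (hb : Monotone b) {a : SeqBelow b} {ω : ℕ → Bool}
    (h : ω ∈ a.walks) : rightSteps ω a.length = a.1 + 1 := by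
  rw [rightSteps, a.filter_eq hb h, card_rightTimes]

lemma SeqBelow.walks_subset (hb : Monotone b) (a : SeqBelow b) :
    a.walks ⊆ stepsRight b ∩ hitsBarrier b := by
  intro ω h
  constructor
  · have h0 : a.2.1 0 ∈ a.rightTimes := Finset.mem_image.2 ⟨0, by simp⟩
    exact ⟨a.2.1 0, by simpa using a.2.2.2 0, (h _ (a.lt_length hb h0)).2 h0⟩
  · refine ⟨a.length, ?_⟩
    have h1 := a.rightSteps_length hb h
    have h2 := upSteps_add_rightSteps ω a.length
    rw [h1] at h2 ⊢
    simp only [length] at h2 ⊢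
    omega

/-- Pigeonhole: if `a'` were longer, its first `a.1 + 2` steps to the right would start at heights
at most `b (a.1 + 1)`, hence before time `a.length`, where `a` allows only `a.1 + 1` of them. -/
lemma SeqBelow.fst_le_of_walks (hb : Monotone b) {a a' : SeqBelow b} {ω : ℕ → Bool}
    (h : ω ∈ a.walks) (h' : ω ∈ a'.walks) : a'.1 ≤ a.1 := by
  by_contra! hlt
  let i : Fin (a'.1 + 1) := ⟨a.1 + 1, by omega⟩
  let g : Fin (a.1 + 1 + 1) → ℕ := fun j => a'.2.1 ⟨j, by omega⟩ + j
  have hg : StrictMono g := fun j k hjk => a'.strictMono_add (by simpa using hjk)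
  have hsub : Finset.univ.image g ⊆ a.rightTimes := by
    intro k hk
    simp only [Finset.mem_image, Finset.mem_univ, true_and] at hk
    obtain ⟨j, rfl⟩ := hk
    have hmem : g j ∈ a'.rightTimes := Finset.mem_image.2 ⟨⟨j, by omega⟩, by simp [g]⟩
    have h1 : a'.2.1 ⟨j, by omega⟩ ≤ b j := a'.2.2.2 ⟨j, by omega⟩
    have h2 : b j ≤ b (a.1 + 1) := hb (by omega)
    have hl : g j < a.length := by simp only [g, length]; omega
    exact (h _ hl).1 ((h' _ (a'.lt_length hb hmem)).2 hmem)
  have := Finset.card_le_card hsub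
  rw [card_rightTimes, Finset.card_image_of_injective _ hg.injective] at this
  simp at this

/-- Equal lengths force equal sets of right times, and such a set has only one increasing
enumeration `a i + i`. -/
lemma SeqBelow.pairwise_disjoint_walks (hb : Monotone b) :
    Pairwise (Function.onFun Disjoint (SeqBelow.walks (b := b))) := by
  intro a a' hne
  rw [Function.onFun, Set.disjoint_left]
  intro ω h h'
  apply hne
  have h1 := le_antisymm (fst_le_of_walks hb h' h) (fst_le_of_walks hb h h')
  have hF : a.rightTimes = a'.rightTimes := by
    rw [← a.filter_eq hb h, ← a'.filter_eq hb h']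
    simp only [length, h1]
  obtain ⟨n, a⟩ := a
  obtain ⟨n', a'⟩ := a'
  obtain rfl : n = n' := h1
  congr 1
  ext i
  have hr : Set.range (fun i : Fin (n + 1) => a.1 i + (i : ℕ)) =
      Set.range fun i : Fin (n + 1) => a'.1 i + (i : ℕ) := by
    have := congrArg (fun s : Finset ℕ => (s : Set ℕ)) hF
    simpa [rightTimes] using this
  have := congrFun ((StrictMono.range_inj (SeqBelow.strictMono_add (b := b) ⟨n, a⟩)
    (SeqBelow.strictMono_add (b := b) ⟨n, a'⟩)).1 hr) i
  exact Nat.add_right_cancel this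

lemma card_filter_lt_orderEmbOfFin {s : Finset ℕ} {k : ℕ} (h : s.card = k) (i : Fin k) :
    (s.filter (· < s.orderEmbOfFin h i)).card = i := by
  have : s.filter (· < s.orderEmbOfFin h i) =
      (Finset.univ.filter (· < i)).image (s.orderEmbOfFin h) := by
    ext x
    simp only [Finset.mem_filter, Finset.mem_image, Finset.mem_univ, true_and]
    constructor
    · rintro ⟨hx, hlt⟩
      obtain ⟨j, rfl⟩ : x ∈ Set.range (s.orderEmbOfFin h) := by simpa using hx
      exact ⟨j, by simpa using hlt, rfl⟩
    · rintro ⟨j, hj, rfl⟩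
      exact ⟨Finset.orderEmbOfFin_mem _ _ _, by simpa using hj⟩
  rw [this, Finset.card_image_of_injective _ (s.orderEmbOfFin h).injective, ← Fin.card_Iio i]
  congr 1
  ext
  simp

lemma SeqBelow.exists_mem_walks (hb : Monotone b) {ω : ℕ → Bool}
    (hs : ω ∈ stepsRight b) (hh : ω ∈ hitsBarrier b) : ∃ a : SeqBelow b, ω ∈ a.walks := by
  classical
  have hex : ∃ n, b (rightSteps ω n) < upSteps ω n := hh
  obtain ⟨N, hN, hmin⟩ : ∃ N, b (rightSteps ω N) < upSteps ω N ∧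
      ∀ m < N, upSteps ω m ≤ b (rightSteps ω m) :=
    ⟨Nat.find hex, Nat.find_spec hex, fun m hm => not_lt.1 (Nat.find_min hex hm)⟩
  -- No overshoot: as `b` is nondecreasing, a step to the right cannot cause a collision, and an
  -- upward step gains only one.
  have hup : upSteps ω N = b (rightSteps ω N) + 1 := by
    obtain ⟨M, rfl⟩ : ∃ M, N = M + 1 := by
      refine Nat.exists_eq_succ_of_ne_zero ?_
      rintro rfl
      simp [upSteps] at hN
    have hM := hmin M (by omega)
    have hr := hb (rightSteps_mono ω (Nat.le_add_right M 1))
    rw [upSteps_succ] at hN ⊢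
    split_ifs at hN ⊢ <;> omega
  have hsum := upSteps_add_rightSteps ω N
  -- Otherwise `N = b 0 + 1` and all these steps are upward.
  have hpos : rightSteps ω N ≠ 0 := by
    intro h0
    obtain ⟨k, hk, hkf⟩ := hs
    rw [h0] at hup
    have : k ∈ (Finset.range N).filter fun k => ω k = false := by
      simp only [Finset.mem_filter, Finset.mem_range]
      exact ⟨by omega, hkf⟩
    rw [Finset.card_eq_zero.1 h0] at this
    simp at this
  obtain ⟨n, hn⟩ := Nat.exists_eq_succ_of_ne_zero hpos
  rw [Nat.succ_eq_add_one] at hn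
  obtain ⟨F, hcard, hF⟩ : ∃ F : Finset ℕ, F.card = n + 1 ∧ ∀ k, k ∈ F ↔ k < N ∧ ω k = false :=
    ⟨(Finset.range N).filter fun k => ω k = false, hn, by simp⟩
  -- `f i` is the time of the step to the right out of column `i`, so `a i` is the height at that
  -- time.
  let f := F.orderEmbOfFin hcard
  have hfN (i) : f i < N := ((hF _).1 (F.orderEmbOfFin_mem hcard i)).1
  have hright (i) : rightSteps ω (f i) = i := by
    rw [← card_filter_lt_orderEmbOfFin hcard i, rightSteps]
    congr 1
    ext k
    have := hfN i
    simp only [hF, Finset.mem_filter, Finset.mem_range]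
    change k < f i ∧ _ ↔ (_ ∧ _) ∧ k < f i
    constructor
    · exact fun h => ⟨⟨by omega, h.2⟩, h.1⟩
    · exact fun h => ⟨h.2, h.1.2⟩
  have hupf (i) : upSteps ω (f i) + i = f i := by
    simpa only [hright] using upSteps_add_rightSteps ω (f i)
  refine ⟨⟨n, fun i => upSteps ω (f i), (upSteps_mono ω).comp f.monotone, fun i => ?_⟩,
    fun k hk => ?_⟩
  · simpa only [hright] using hmin (f i) (hfN i)
  · simp only [length, ← hn, ← hup, hsum] at hk
    simp only [rightTimes, hupf]
    rw [Finset.mem_image]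
    have : k ∈ Set.range f ↔ k ∈ F := by rw [Finset.range_orderEmbOfFin, Finset.mem_coe]
    simp only [Finset.mem_univ, true_and]
    rw [← Set.mem_range, this, hF]
    simp [hk]

end Paths

/-! ### Probabilities of cylinders and the sum of the weights. -/

section Law

variable (p : I)

instance isProbabilityMeasure_walkLaw : IsProbabilityMeasure (walkLaw p) := by
  unfold walkLaw
  infer_instance

lemma bernoulliMeasure_singleton_false :
    bernoulliMeasure false true p {false} = ENNReal.ofReal p := by
  rw [bernoulliMeasure_apply_of_mem_of_notMem p (.singleton _) (by simp) (by simp)]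
  simp [ENNReal.ofReal, unitInterval.toNNReal, Real.toNNReal_of_nonneg p.2.1]
  rfl

lemma bernoulliMeasure_singleton_true :
    bernoulliMeasure false true p {true} = ENNReal.ofReal (1 - p) := by
  rw [bernoulliMeasure_apply_of_notMem_of_mem p (.singleton _) (by simp) (by simp)]
  have : (0 : ℝ) ≤ 1 - p := sub_nonneg.2 p.2.2
  simp [ENNReal.ofReal, unitInterval.toNNReal, Real.toNNReal_of_nonneg this]
  rfl

/-- The probability that the walk begins with a given finite path. -/
lemma walkLaw_cylinder (L : ℕ) (F : Finset ℕ) (hF : F ⊆ Finset.range L) :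
    walkLaw p {ω | ∀ k < L, ω k = false ↔ k ∈ F} =
      ENNReal.ofReal ((p : ℝ) ^ F.card * (1 - p) ^ (L - F.card)) := by
  classical
  have hset : {ω : ℕ → Bool | ∀ k < L, ω k = false ↔ k ∈ F} =
      Set.pi (Finset.range L : Set ℕ) fun k => {!decide (k ∈ F)} := by
    ext ω
    simp only [Set.mem_ofPred_eq, Set.mem_pi, Finset.coe_range, Set.mem_Iio, Set.mem_singleton_iff]
    refine forall₂_congr fun k _ => ?_
    by_cases hk : k ∈ F <;> simp [hk]
  have hterm (k : ℕ) : bernoulliMeasure false true p {!decide (k ∈ F)} =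
      if k ∈ F then ENNReal.ofReal p else ENNReal.ofReal (1 - p) := by
    split_ifs with hk
    · simpa [hk] using bernoulliMeasure_singleton_false p
    · simpa [hk] using bernoulliMeasure_singleton_true p
  rw [hset, walkLaw, Measure.infinitePi_pi _ fun _ _ => .singleton _]
  simp only [hterm]
  have h1 : (Finset.range L).filter (· ∈ F) = F := by
    rw [Finset.filter_mem_eq_inter, Finset.inter_eq_right.2 hF]
  have h2 : ((Finset.range L).filter (· ∉ F)).card = L - F.card := by
    rw [Finset.filter_notMem_eq_sdiff, Finset.card_sdiff_of_subset hF, Finset.card_range]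
  rw [Finset.prod_ite, Finset.prod_const, Finset.prod_const, h1, h2,
    ENNReal.ofReal_mul (pow_nonneg p.2.1 _), ENNReal.ofReal_pow p.2.1,
    ENNReal.ofReal_pow (sub_nonneg.2 p.2.2)]

lemma walkLaw_walks {b : ℕ → ℕ} (hb : Monotone b) (a : SeqBelow b) :
    walkLaw p a.walks =
      ENNReal.ofReal ((p : ℝ) ^ (a.1 + 1) * (1 - p) ^ (b (a.1 + 1) + 1)) := by
  have := walkLaw_cylinder p a.length a.rightTimes fun k hk =>
    Finset.mem_range.2 (a.lt_length hb hk)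
  rwa [a.card_rightTimes, SeqBelow.length, Nat.add_sub_cancel] at this

lemma measurableSet_walks {b : ℕ → ℕ} (a : SeqBelow b) : MeasurableSet a.walks := by
  have : a.walks = ⋂ k ∈ Set.Iio a.length,
      (fun ω : ℕ → Bool => ω k) ⁻¹' {x | x = false ↔ k ∈ a.rightTimes} := by
    ext; simp [SeqBelow.walks]
  rw [this]
  exact .biInter (Set.to_countable _) fun k _ => measurable_pi_apply k (Set.toFinite _).measurableSet

lemma walkLaw_real_stepsRight (b : ℕ → ℕ) :
    (walkLaw p).real (stepsRight b) = 1 - (1 - (p : ℝ)) ^ (1 + b 0) := by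
  have hc : (stepsRight b)ᶜ = {ω | ∀ k < 1 + b 0, ω k = false ↔ k ∈ (∅ : Finset ℕ)} := by
    ext ω
    simp only [stepsRight, Set.mem_compl_iff, Set.mem_ofPred_eq, not_exists, not_and,
      Finset.notMem_empty, iff_false]
    exact forall_congr' fun k => by rw [Nat.lt_one_add_iff]
  have h := walkLaw_cylinder p (1 + b 0) ∅ (by simp)
  rw [← hc] at h
  have h2 : (walkLaw p).real (stepsRight b)ᶜ = (1 - (p : ℝ)) ^ (1 + b 0) := by
    rw [measureReal_def, h]
    simp [ENNReal.toReal_ofReal (pow_nonneg (sub_nonneg.2 p.2.2) _)]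
  rw [probReal_compl_eq_one_sub (measurableSet_stepsRight b)] at h2
  linarith

lemma walkLaw_real_stepsRight_pos (hp : 0 < (p : ℝ)) (b : ℕ → ℕ) :
    0 < (walkLaw p).real (stepsRight b) := by
  rw [walkLaw_real_stepsRight, sub_pos]
  exact pow_lt_one₀ (sub_nonneg.2 p.2.2) (by linarith) (by omega)

lemma walkLaw_stepsRight_ne_zero (hp : 0 < (p : ℝ)) (b : ℕ → ℕ) :
    walkLaw p (stepsRight b) ≠ 0 := fun h => by
  simpa [measureReal_def, h] using walkLaw_real_stepsRight_pos p hp b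

lemma cond_real_hitsBarrier (b : ℕ → ℕ) :
    (cond (walkLaw p) (stepsRight b)).real (hitsBarrier b) =
      (walkLaw p).real (stepsRight b ∩ hitsBarrier b) / (1 - (1 - (p : ℝ)) ^ (1 + b 0)) := by
  rw [← walkLaw_real_stepsRight, measureReal_def, cond_apply (measurableSet_stepsRight b),
    ENNReal.toReal_mul, ENNReal.toReal_inv, div_eq_inv_mul, measureReal_def, measureReal_def]

/-- The weights sum up to the conditional probability of a collision with the barrier. -/
lemma hasSum_weight {b : ℕ → ℕ} (hb : Monotone b) :
    HasSum (weight b p) ((cond (walkLaw p) (stepsRight b)).real (hitsBarrier b)) := by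
  have hU : ⋃ a : SeqBelow b, a.walks = stepsRight b ∩ hitsBarrier b := by
    refine (Set.iUnion_subset fun a => a.walks_subset hb).antisymm fun ω h => ?_
    exact Set.mem_iUnion.2 (SeqBelow.exists_mem_walks hb h.1 h.2)
  have hsum : HasSum (fun a : SeqBelow b => (walkLaw p).real a.walks)
      ((walkLaw p).real (stepsRight b ∩ hitsBarrier b)) := by
    have h1 := measure_iUnion (μ := walkLaw p) (SeqBelow.pairwise_disjoint_walks hb)
      measurableSet_walks
    rw [hU] at h1
    simp only [measureReal_def]
    rw [h1, ENNReal.tsum_toReal_eq fun a => measure_ne_top _ _]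
    exact (ENNReal.summable_toReal (h1 ▸ measure_ne_top _ _)).hasSum
  rw [cond_real_hitsBarrier]
  refine (hsum.div_const _).congr_fun fun a => ?_
  rw [weight, measureReal_def, walkLaw_walks p hb, ENNReal.toReal_ofReal]
  have : (0 : ℝ) ≤ 1 - p := sub_nonneg.2 p.2.2
  have := p.2.1
  positivity

end Law

/-! ### Restarting the walk, the strong law, and the noncritical slopes. -/

section Asymptotics

variable (p : I)

lemma measurable_shift (l : ℕ) : Measurable fun (ω : ℕ → Bool) k => ω (k + l) :=
  measurable_pi_iff.2 fun k => measurable_pi_apply (k + l)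

lemma map_shift_walkLaw (l : ℕ) :
    (walkLaw p).map (fun ω k => ω (k + l)) = walkLaw p :=
  Measure.map_infinitePi_infinitePi_of_inj
    (P := fun _ : ℕ => bernoulliMeasure false true p) (add_left_injective l)

/-- After any fixed time the walk starts afresh, independently of its past. -/
lemma walkLaw_inter_shift_preimage (l : ℕ) {A B : Set (ℕ → Bool)}
    (hA : MeasurableSet[⨆ k ∈ Set.Iio l, MeasurableSpace.comap (fun ω : ℕ → Bool => ω k) ⊤] A)
    (hB : MeasurableSet B) :
    walkLaw p (A ∩ (fun ω k => ω (k + l)) ⁻¹' B) = walkLaw p A * walkLaw p B := by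
  have hind : iIndep (fun k => MeasurableSpace.comap (fun ω : ℕ → Bool => ω k) ⊤) (walkLaw p) :=
    iIndepFun_infinitePi (P := fun _ : ℕ => bernoulliMeasure false true p)
      (X := fun _ x => x) fun _ => measurable_id
  have h2 := indep_iSup_of_disjoint (fun k => (measurable_pi_apply k).comap_le) hind
    (Set.Iio_disjoint_Ici (le_refl l))
  have hB' : MeasurableSet[⨆ k ∈ Set.Ici l,
      MeasurableSpace.comap (fun ω : ℕ → Bool => ω k) ⊤] ((fun ω k => ω (k + l)) ⁻¹' B) := by
    refine (@measurable_pi_iff _ _ _ (_) _ _).2 (fun k => ?_) hB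
    rw [measurable_iff_comap_le]
    exact le_iSup₂_of_le (k + l) (Nat.le_add_left l k) le_rfl
  rw [(Indep_iff _ _ _).1 h2 A _ hA hB', ← Measure.map_apply (measurable_shift l) hB,
    map_shift_walkLaw]

lemma measurable_upSteps_past (l : ℕ) :
    Measurable[⨆ k ∈ Set.Iio l, MeasurableSpace.comap (fun ω : ℕ → Bool => ω k) ⊤]
      fun ω => upSteps ω l := by
  simp only [upSteps, Finset.card_filter]
  refine Finset.measurable_fun_sum _ fun k hk => ?_
  refine (measurable_from_top (f := fun x : Bool => if x = true then 1 else 0)).comp ?_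
  rw [measurable_iff_comap_le]
  exact le_iSup₂_of_le k (by simpa using hk) le_rfl

/-- The height of step number `k`. -/
def rise (k : ℕ) (ω : ℕ → Bool) : ℝ := if ω k = true then 1 else 0

lemma sum_rise (n : ℕ) (ω : ℕ → Bool) : ∑ k ∈ Finset.range n, rise k ω = upSteps ω n := by
  simp [rise, upSteps]

lemma rise_eq_comp (k : ℕ) :
    rise k = (fun x : Bool => if x = true then (1 : ℝ) else 0) ∘ fun ω => ω k := rfl

lemma measurable_rise (k : ℕ) : Measurable (rise k) :=
  (Measurable.of_discrete (f := fun x : Bool => if x = true then (1 : ℝ) else 0)).comp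
    (measurable_pi_apply k)

lemma iIndepFun_rise : iIndepFun rise (walkLaw p) :=
  iIndepFun_infinitePi (P := fun _ : ℕ => bernoulliMeasure false true p)
    (X := fun _ x => if x = true then (1 : ℝ) else 0) fun _ => measurable_from_top

lemma map_eval_walkLaw (k : ℕ) :
    (walkLaw p).map (fun ω => ω k) = bernoulliMeasure false true p :=
  Measure.infinitePi_map_eval (fun _ : ℕ => bernoulliMeasure false true p) k

lemma identDistrib_rise (k : ℕ) : IdentDistrib (rise k) (rise 0) (walkLaw p) (walkLaw p) where
  aemeasurable_fst := (measurable_rise k).aemeasurable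
  aemeasurable_snd := (measurable_rise 0).aemeasurable
  map_eq := by
    rw [rise_eq_comp, rise_eq_comp, ← Measure.map_map measurable_from_top (measurable_pi_apply k),
      ← Measure.map_map measurable_from_top (measurable_pi_apply 0), map_eval_walkLaw,
      map_eval_walkLaw]

lemma memLp_rise (k : ℕ) : MemLp (rise k) 2 (walkLaw p) := by
  refine MemLp.of_bound (measurable_rise k).aestronglyMeasurable 1 (.of_forall fun ω => ?_)
  unfold rise
  split_ifs <;> simp

lemma integral_rise (k : ℕ) : ∫ ω, rise k ω ∂walkLaw p = 1 - p := by
  have h : rise k = Set.indicator ((fun ω => ω k) ⁻¹' {true}) 1 := by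
    ext ω
    by_cases hω : ω k = true <;> simp [rise, hω]
  rw [h, integral_indicator_one (measurable_pi_apply k (.singleton _)), measureReal_def,
    ← Measure.map_apply (measurable_pi_apply k) (.singleton _), map_eval_walkLaw,
    bernoulliMeasure_singleton_true, ENNReal.toReal_ofReal (sub_nonneg.2 p.2.2)]

lemma variance_rise (k : ℕ) : Var[rise k; walkLaw p] = p * (1 - p) := by
  have h : rise k ^ 2 = rise k := by
    ext ω
    simp [rise]
  rw [variance_eq_sub (memLp_rise p k), h, integral_rise]
  ring

/-- The proportion of upward steps tends to their probability. -/
lemma tendsto_upSteps_div :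
    ∀ᵐ ω ∂walkLaw p, Tendsto (fun n : ℕ => (upSteps ω n : ℝ) / n) atTop (nhds (1 - p)) := by
  have h := strong_law_ae_real rise ((memLp_rise p 0).integrable (by norm_num))
    (fun i j hij => (iIndepFun_rise p).indepFun hij) (identDistrib_rise p)
  simpa only [sum_rise, integral_rise] using h

lemma cast_rightSteps (ω : ℕ → Bool) (n : ℕ) : (rightSteps ω n : ℝ) = n - upSteps ω n := by
  rw [eq_sub_iff_add_eq']
  exact_mod_cast upSteps_add_rightSteps ω n

/-- As right steps number `n` minus upward steps, the claim says that the upward proportion is below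
`c / (1 + c)`. -/
lemma eventually_upSteps_lt {ω : ℕ → Bool} {q c : ℝ} (hc : -1 < c) (hq : q < c * (1 - q))
    (h : Tendsto (fun n : ℕ => (upSteps ω n : ℝ) / n) atTop (nhds q)) :
    ∀ᶠ n in atTop, (upSteps ω n : ℝ) < c * rightSteps ω n := by
  have h' : q < c / (1 + c) := by
    rw [lt_div_iff₀ (by linarith)]
    linarith
  filter_upwards [h.eventually_lt_const h', eventually_gt_atTop 0] with n hn hn0
  have hn0 : (0 : ℝ) < n := by exact_mod_cast hn0
  rw [div_lt_div_iff₀ hn0 (by linarith)] at hn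
  rw [cast_rightSteps]
  linarith

lemma eventually_lt_upSteps {ω : ℕ → Bool} {q c : ℝ} (hc : -1 < c) (hq : c * (1 - q) < q)
    (h : Tendsto (fun n : ℕ => (upSteps ω n : ℝ) / n) atTop (nhds q)) :
    ∀ᶠ n in atTop, c * rightSteps ω n < upSteps ω n := by
  have h' : c / (1 + c) < q := by
    rw [div_lt_iff₀ (by linarith)]
    linarith
  filter_upwards [h.eventually_const_lt h', eventually_gt_atTop 0] with n hn hn0
  have hn0 : (0 : ℝ) < n := by exact_mod_cast hn0
  rw [div_lt_div_iff₀ (by linarith) hn0] at hn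
  rw [cast_rightSteps]
  linarith

/-- A walk with asymptotically a positive proportion of steps to the right makes infinitely many
of them. -/
lemma exists_le_rightSteps {ω : ℕ → Bool} {q : ℝ} (hq : q < 1)
    (h : Tendsto (fun n : ℕ => (upSteps ω n : ℝ) / n) atTop (nhds q)) (i : ℕ) :
    ∃ n, i ≤ rightSteps ω n := by
  have h1 : Tendsto (fun n : ℕ => (n : ℝ) * (1 - (upSteps ω n : ℝ) / n)) atTop atTop :=
    tendsto_natCast_atTop_atTop.atTop_mul_pos (sub_pos.2 hq) (h.const_sub 1)
  obtain ⟨n, hn, hn0⟩ := ((h1.eventually_ge_atTop (i : ℝ)).and (eventually_gt_atTop 0)).exists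
  refine ⟨n, ?_⟩
  have hn0 : (n : ℝ) ≠ 0 := by exact_mod_cast hn0.ne'
  have : (i : ℝ) ≤ rightSteps ω n := by
    rw [cast_rightSteps]
    refine hn.trans_eq ?_
    field_simp
  exact_mod_cast this

variable {p}

lemma ae_hitsBarrier_of_lowerSlope_lt {b : ℕ → ℕ} (hp : 0 < (p : ℝ))
    (h : lowerSlope b < ENNReal.ofReal ((1 - p) / p)) :
    ∀ᵐ ω ∂walkLaw p, ω ∈ hitsBarrier b := by
  obtain ⟨c, hbc, hcq⟩ := ENNReal.lt_iff_exists_nnreal_btwn.1 h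
  have hcq : (c : ℝ) * p < 1 - p := by
    rwa [← ENNReal.ofReal_coe_nnreal, ENNReal.ofReal_lt_ofReal_iff_of_nonneg c.coe_nonneg,
      lt_div_iff₀ hp] at hcq
  have hfreq := frequently_lt_of_liminf_lt (by isBoundedDefault) hbc
  filter_upwards [tendsto_upSteps_div p] with ω hω
  obtain ⟨N, hN⟩ := eventually_atTop.1
    (eventually_lt_upSteps (c := c) (by linarith [NNReal.coe_nonneg c]) (by linarith) hω)
  obtain ⟨i, hbi, hiN⟩ := (hfreq.and_eventually (eventually_gt_atTop N)).exists
  obtain ⟨m, hm⟩ := exists_le_rightSteps (by linarith) hω i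
  obtain ⟨n, rfl⟩ := exists_rightSteps_eq ω hm
  have hn := hN n (by have := upSteps_add_rightSteps ω n; omega)
  refine ⟨n, ?_⟩
  rw [ENNReal.div_lt_iff (.inl (by exact_mod_cast (by omega : rightSteps ω n ≠ 0)))
    (.inl (ENNReal.natCast_ne_top _))] at hbi
  have hbi : (b (rightSteps ω n) : ℝ) < c * rightSteps ω n := by exact_mod_cast hbi
  exact_mod_cast hbi.trans hn

/-- The event that the walk stays below the line of slope `c` starting at height `M`. -/
def staysBelow (c : ℝ) (M : ℕ) : Set (ℕ → Bool) :=
  {ω | ∀ n, (upSteps ω n : ℝ) ≤ c * rightSteps ω n + M}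

lemma measurableSet_staysBelow (c : ℝ) (M : ℕ) : MeasurableSet (staysBelow c M) := by
  have : staysBelow c M = ⋂ n, {ω | (upSteps ω n : ℝ) ≤ c * rightSteps ω n + M} := by
    ext; simp [staysBelow]
  rw [this]
  refine .iInter fun n => measurableSet_le ?_ ?_
  · exact measurable_from_top.comp (measurable_upSteps n)
  · exact ((measurable_from_top.comp (measurable_rightSteps n)).const_mul c).add_const _

/-- Almost every walk is below the unraised line from some time `N` on, and earlier its height is at
most `N`; so the events for all `M` together have full measure. -/
lemma exists_walkLaw_staysBelow_pos {c : ℝ} (hc : 0 ≤ c) (hcq : 1 - (p : ℝ) < c * p) :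
    ∃ M, walkLaw p (staysBelow c M) ≠ 0 := by
  by_contra! h
  have h0 := measure_iUnion_null h
  have h1 : ∀ᵐ ω ∂walkLaw p, ω ∈ ⋃ M, staysBelow c M := by
    filter_upwards [tendsto_upSteps_div p] with ω hω
    obtain ⟨N, hN⟩ := eventually_atTop.1
      (eventually_upSteps_lt (c := c) (by linarith) (by linarith) hω)
    refine Set.mem_iUnion.2 ⟨N, fun n => ?_⟩
    have : 0 ≤ c * rightSteps ω n := by positivity
    rcases le_total N n with hn | hn
    · have := hN n hn
      have : (0 : ℝ) ≤ N := by positivity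
      linarith
    · have : upSteps ω n ≤ N := by have := upSteps_add_rightSteps ω n; omega
      have : (upSteps ω n : ℝ) ≤ N := by exact_mod_cast this
      linarith
  obtain ⟨ω, hω, hω'⟩ := (h1.and (measure_eq_zero_iff_ae_notMem.1 h0)).exists
  exact hω' hω

lemma walkLaw_stepsRight_diff_hitsBarrier_ne_zero {b : ℕ → ℕ} (hp : 0 < (p : ℝ))
    (h : ENNReal.ofReal ((1 - p) / p) < lowerSlope b) :
    walkLaw p (stepsRight b \ hitsBarrier b) ≠ 0 := by
  obtain ⟨c, hcq, hbc⟩ := ENNReal.lt_iff_exists_nnreal_btwn.1 h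
  have hcq : 1 - (p : ℝ) < c * p := by
    rwa [← ENNReal.ofReal_coe_nnreal, ENNReal.ofReal_lt_ofReal_iff_of_nonneg
      (div_nonneg (sub_nonneg.2 p.2.2) hp.le), div_lt_iff₀ hp] at hcq
  have hc0 : (0 : ℝ) < c := by
    by_contra! h0
    have := mul_nonpos_of_nonpos_of_nonneg h0 hp.le
    have := p.2.2
    linarith
  obtain ⟨N, hN⟩ := eventually_atTop.1
    ((eventually_lt_of_lt_liminf hbc (by isBoundedDefault)).and (eventually_gt_atTop 0))
  obtain ⟨M, hM⟩ := exists_walkLaw_staysBelow_pos (NNReal.coe_nonneg c) hcq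
  obtain ⟨R₀, hR₀⟩ := exists_nat_ge ((M : ℝ) / c)
  -- Length of the initial run to the right: `R₀` pays for the offset `M`, `N` reaches the columns
  -- with `b i > c * i`, and `1` puts the walk in `stepsRight b`.
  set R := R₀ + N + 1
  have hR : (M : ℝ) ≤ c * R := by
    rw [div_le_iff₀ hc0] at hR₀
    have : (R₀ : ℝ) ≤ R := by exact_mod_cast (by omega : R₀ ≤ R)
    nlinarith
  have hpast : MeasurableSet[⨆ k ∈ Set.Iio R,
      MeasurableSpace.comap (fun ω : ℕ → Bool => ω k) ⊤] {ω | upSteps ω R = 0} :=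
    measurable_upSteps_past R (.singleton 0)
  have hprod := walkLaw_inter_shift_preimage p R hpast (measurableSet_staysBelow c M)
  have hzero : {ω : ℕ → Bool | upSteps ω R = 0} =
      {ω | ∀ k < R, ω k = false ↔ k ∈ Finset.range R} := by
    ext ω
    simp only [upSteps, Set.mem_ofPred_eq, Finset.card_eq_zero, Finset.filter_eq_empty_iff,
      Finset.mem_range]
    exact forall₂_congr fun k hk => by simp [hk]
  have hpos : walkLaw p {ω | upSteps ω R = 0} ≠ 0 := by
    rw [hzero, walkLaw_cylinder p R _ subset_rfl]
    simp [hp]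
  have hne := mul_ne_zero hpos hM
  rw [← hprod] at hne
  refine fun h0 => hne (measure_mono_null ?_ h0)
  rintro ω ⟨hω, hshift⟩
  have hω : upSteps ω R = 0 := hω
  have hright : rightSteps ω R = R := by have := upSteps_add_rightSteps ω R; omega
  refine ⟨⟨0, Nat.zero_le _, ?_⟩, ?_⟩
  · have : ω ∈ {ω : ℕ → Bool | upSteps ω R = 0} := hω
    rw [hzero] at this
    exact (this 0 (by omega)).2 (Finset.mem_range.2 (by omega))
  · rintro ⟨n, hn⟩
    rcases le_total n R with hnR | hnR
    · have := upSteps_mono ω hnR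
      omega
    · obtain ⟨m, rfl⟩ := Nat.exists_eq_add_of_le hnR
      rw [upSteps_add, rightSteps_add, hω, hright, zero_add] at hn
      have h1 := hshift m
      obtain ⟨h2, -⟩ := hN (R + rightSteps (fun k => ω (k + R)) m) (by omega)
      rw [ENNReal.lt_div_iff_mul_lt (.inl (by exact_mod_cast (by omega)))
        (.inl (ENNReal.natCast_ne_top _))] at h2
      have h2 : (c : ℝ) * (R + rightSteps (fun k => ω (k + R)) m : ℕ) <
        b (R + rightSteps (fun k => ω (k + R)) m) := by exact_mod_cast h2
      have h3 : (b (R + rightSteps (fun k => ω (k + R)) m) : ℝ) <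
        upSteps (fun k => ω (k + R)) m := by exact_mod_cast hn
      push_cast at h2
      linarith

end Asymptotics

/-! ### The critical slope, via the central limit theorem. -/

section Critical

variable (p : I)

/-- Upward deviations of the order of the square root of time do not become improbable. -/
lemma exists_lt_walkLaw_deviation (hp : 0 < (p : ℝ)) (hp1 : (p : ℝ) < 1) (K : ℝ) :
    ∃ δ : ℝ≥0∞, δ ≠ 0 ∧ ∀ᶠ n : ℕ in atTop,
      δ < walkLaw p {ω | (1 - (p : ℝ)) * n + K * √n < upSteps ω n} := by
  set v := Var[rise 0; walkLaw p].toNNReal with hv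
  have hv0 : v ≠ 0 := by
    rw [hv, variance_rise, Ne, Real.toNNReal_eq_zero, not_le]
    exact mul_pos hp (sub_pos.2 hp1)
  have hclt := (tendstoInDistribution_inv_sqrt_mul_sum_sub (P' := gaussianReal 0 v)
    (Y := id) ⟨aemeasurable_id, Measure.map_id⟩ (memLp_rise p 0) (iIndepFun_rise p)
    (identDistrib_rise p))
  -- Portmanteau inequality on `(K, ∞)`, which has positive Gaussian mass; half of that mass serves
  -- as `δ`.
  have hlim := ProbabilityMeasure.le_liminf_measure_open_of_tendsto hclt.tendsto
    (isOpen_Ioi (a := K))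
  simp only [ProbabilityMeasure.coe_mk, Measure.map_id] at hlim
  have hpos : gaussianReal 0 v (Set.Ioi K) ≠ 0 := fun h => by
    have := gaussianReal_absolutelyContinuous' 0 hv0 h
    simp at this
  have hhalf := ENNReal.half_lt_self hpos (measure_ne_top _ _)
  refine ⟨_, (ENNReal.half_pos hpos).ne', ?_⟩
  filter_upwards [eventually_lt_of_lt_liminf (hhalf.trans_le hlim) (by isBoundedDefault),
    eventually_gt_atTop 0] with n hn hn0
  have hn0 : (0 : ℝ) < √n := Real.sqrt_pos.2 (by exact_mod_cast hn0)
  rw [Measure.map_apply_of_aemeasurable (hclt.forall_aemeasurable n) measurableSet_Ioi] at hn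
  refine hn.trans_le (measure_mono fun ω hω => ?_)
  simp only [Set.mem_preimage, Set.mem_Ioi, sum_rise, integral_rise] at hω
  rw [lt_inv_mul_iff₀ hn0] at hω
  change (1 - (p : ℝ)) * n + K * √n < upSteps ω n
  linarith

/-- The event that the height of the walk never exceeds its mean by more than `C * √n + M`. -/
def boundedDeviation (C : ℝ) (M : ℕ) : Set (ℕ → Bool) :=
  {ω | ∀ n : ℕ, (upSteps ω n : ℝ) ≤ (1 - (p : ℝ)) * n + C * √n + M}

lemma measurableSet_boundedDeviation (C : ℝ) (M : ℕ) :
    MeasurableSet (boundedDeviation p C M) := by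
  have : boundedDeviation p C M =
      ⋂ n : ℕ, {ω | (upSteps ω n : ℝ) ≤ (1 - (p : ℝ)) * n + C * √n + M} := by
    ext; simp [boundedDeviation]
  rw [this]
  exact .iInter fun n => measurableSet_le (measurable_from_top.comp (measurable_upSteps n))
    measurable_const

lemma walkLaw_boundedDeviation (hp : 0 < (p : ℝ)) (hp1 : (p : ℝ) < 1) {C : ℝ} (hC : 0 ≤ C)
    (M : ℕ) : walkLaw p (boundedDeviation p C M) = 0 := by
  -- The extra `√l` in `C + 1` will absorb `M` once `l ≥ M ^ 2`. This keeps `δ` independent of `M`.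
  obtain ⟨δ, hδ, hdev⟩ := exists_lt_walkLaw_deviation p hp hp1 (C + 1)
  set s := ⨆ M, walkLaw p (boundedDeviation p C M) with hs
  have hstep (M : ℕ) : walkLaw p (boundedDeviation p C M) ≤ (1 - δ) * s := by
    obtain ⟨l, hl, hlM⟩ := (hdev.and (eventually_ge_atTop (M ^ 2))).exists
    have hlM : (M : ℝ) ≤ √l := Real.le_sqrt_of_sq_le (by exact_mod_cast hlM)
    obtain ⟨T, hT⟩ := exists_nat_ge (C * √l)
    have hpast : MeasurableSet[⨆ k ∈ Set.Iio l,
        MeasurableSpace.comap (fun ω : ℕ → Bool => ω k) ⊤]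
        {ω | (1 - (p : ℝ)) * l + (C + 1) * √l < upSteps ω l}ᶜ :=
      (measurable_upSteps_past l
        (t := {k | (1 - (p : ℝ)) * l + (C + 1) * √l < k}) .of_discrete).compl
    have hmeas : MeasurableSet {ω | (1 - (p : ℝ)) * l + (C + 1) * √l < upSteps ω l} :=
      measurableSet_lt measurable_const (measurable_from_top.comp (measurable_upSteps l))
    -- The bound at time `l` excludes the large deviation. After `l` the restarted walk obeys a
    -- bound of the same form, since `√(l + n) ≤ √l + √n`: `T` covers `C * √l`, and `l` covers the
    -- mean up to time `l`.
    have hsub : boundedDeviation p C M ⊆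
        {ω | (1 - (p : ℝ)) * l + (C + 1) * √l < upSteps ω l}ᶜ ∩
          (fun ω k => ω (k + l)) ⁻¹' boundedDeviation p C (M + l + T) := by
      intro ω hω
      constructor
      · change ¬ (1 - (p : ℝ)) * l + (C + 1) * √l < upSteps ω l
        have := hω l
        linarith
      · intro n
        have h1 := hω (l + n)
        rw [upSteps_add] at h1
        push_cast at h1 ⊢
        have h2 : √(l + n : ℝ) ≤ √l + √n := by
          rw [Real.sqrt_le_left (by positivity), add_sq, Real.sq_sqrt (by positivity),
            Real.sq_sqrt (by positivity)]
          nlinarith [mul_nonneg (Real.sqrt_nonneg (l : ℝ)) (Real.sqrt_nonneg (n : ℝ))]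
        have h3 := mul_le_mul_of_nonneg_left h2 hC
        have h4 : 0 ≤ (p : ℝ) * l := by positivity
        have h5 : (0 : ℝ) ≤ upSteps ω l := by positivity
        linarith
    refine (measure_mono hsub).trans ?_
    rw [walkLaw_inter_shift_preimage p l hpast (measurableSet_boundedDeviation p C _),
      prob_compl_eq_one_sub hmeas]
    exact mul_le_mul' (tsub_le_tsub_left hl.le 1) (le_iSup (fun M => walkLaw p _) (M + l + T))
  have hs1 : s ≤ 1 := iSup_le fun M => prob_le_one
  have hs0 : s = 0 := by
    by_contra hne
    have hlt : (1 - δ) * s < 1 * s :=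
      ENNReal.mul_lt_mul_left hne (hs1.trans_lt ENNReal.one_lt_top).ne
        (ENNReal.sub_lt_self ENNReal.one_ne_top one_ne_zero hδ)
    rw [one_mul] at hlt
    exact (iSup_le hstep).not_gt hlt
  exact nonpos_iff_eq_zero.1 ((le_iSup (fun M => walkLaw p (boundedDeviation p C M)) M).trans hs0.le)

variable {p}

lemma ae_hitsBarrier_of_isBigO {b : ℕ → ℕ} (hb : Monotone b) (hp : 0 < (p : ℝ))
    (hp1 : (p : ℝ) < 1)
    (h : (fun n : ℕ => |(b n : ℝ) - (1 - p) / p * n|) =O[atTop] (fun n : ℕ => √(n : ℝ))) :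
    ∀ᵐ ω ∂walkLaw p, ω ∈ hitsBarrier b := by
  obtain ⟨C, hC, hbound⟩ := h.exists_nonneg
  obtain ⟨N, hN⟩ := eventually_atTop.1 hbound.bound
  -- The constant `b N` covers the columns up to `N`, by monotonicity.
  have hle (n : ℕ) : (b n : ℝ) ≤ (1 - p) / p * n + C * √n + b N := by
    have h1 : 0 ≤ (1 - (p : ℝ)) / p * n :=
      mul_nonneg (div_nonneg (by linarith) hp.le) (Nat.cast_nonneg n)
    have h2 : 0 ≤ C * √n := by positivity
    rcases le_total n N with hn | hn
    · have : (b n : ℝ) ≤ b N := by exact_mod_cast hb hn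
      linarith
    · have h3 := hN n hn
      rw [Real.norm_eq_abs, abs_abs, Real.norm_of_nonneg (Real.sqrt_nonneg _)] at h3
      have := (le_abs_self _).trans h3
      have : (0 : ℝ) ≤ b N := by positivity
      linarith
  filter_upwards [measure_eq_zero_iff_ae_notMem.1
    (walkLaw_boundedDeviation p hp hp1 hC (b N))] with ω hω
  by_contra hnot
  refine hω fun n => ?_
  have h1 : upSteps ω n ≤ b (rightSteps ω n) := not_lt.1 fun hlt => hnot ⟨n, hlt⟩
  have h2 : (upSteps ω n : ℝ) ≤ b (rightSteps ω n) := by exact_mod_cast h1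
  have h3 := h2.trans (hle (rightSteps ω n))
  have h4 : C * √(rightSteps ω n : ℝ) ≤ C * √n := by
    have : rightSteps ω n ≤ n := by have := upSteps_add_rightSteps ω n; omega
    gcongr
  have h5 : (upSteps ω n : ℝ) ≤ (1 - p) / p * rightSteps ω n + (C * √n + b N) := by linarith
  -- Multiplying by `p` and replacing right steps by `n` minus upward steps turns a bound by column
  -- into one by time.
  have h6 := mul_le_mul_of_nonneg_left h5 hp.le
  have h7 : (p : ℝ) * (C * √n + b N) ≤ 1 * (C * √n + b N) :=
    mul_le_mul_of_nonneg_right hp1.le (by positivity)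
  have h8 : (p : ℝ) * ((1 - p) / p * rightSteps ω n) = (1 - p) * rightSteps ω n := by
    field_simp
  rw [mul_add, h8, cast_rightSteps] at h6
  linarith

lemma cond_real_hitsBarrier_eq_one {b : ℕ → ℕ} (hp : 0 < (p : ℝ))
    (h : ∀ᵐ ω ∂walkLaw p, ω ∈ hitsBarrier b) :
    (cond (walkLaw p) (stepsRight b)).real (hitsBarrier b) = 1 := by
  have := cond_isProbabilityMeasure (walkLaw_stepsRight_ne_zero p hp b)
  have h' : ∀ᵐ ω ∂cond (walkLaw p) (stepsRight b), ω ∈ hitsBarrier b :=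
    cond_absolutelyContinuous.ae_le h
  rw [measureReal_def, (mem_ae_iff_prob_eq_one (measurableSet_hitsBarrier b)).1 h', ENNReal.toReal_one]

lemma cond_real_hitsBarrier_ne_one {b : ℕ → ℕ} (hp : 0 < (p : ℝ))
    (h : walkLaw p (stepsRight b \ hitsBarrier b) ≠ 0) :
    (cond (walkLaw p) (stepsRight b)).real (hitsBarrier b) ≠ 1 := by
  rw [cond_real_hitsBarrier, ← walkLaw_real_stepsRight, Ne,
    div_eq_one_iff_eq (walkLaw_real_stepsRight_pos p hp b).ne']
  have h1 := measureReal_inter_add_sdiff (μ := walkLaw p) (s := stepsRight b)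
    (measurableSet_hitsBarrier b)
  have h2 : 0 < (walkLaw p).real (stepsRight b \ hitsBarrier b) :=
    ENNReal.toReal_pos h (measure_ne_top _ _)
  linarith

end Critical

theorem theorem3 (b : ℕ → ℕ) (hb : Monotone b) (p : ℝ) (hp : p ∈ Set.Ioo (0 : ℝ) 1) :
    HasSum (weight b p)
        ((cond (walkLaw ⟨p, Set.Ioo_subset_Icc_self hp⟩) (stepsRight b)).real (hitsBarrier b)) ∧
      ∑' a, weight b p a ≤ 1 ∧
      (lowerSlope b < ENNReal.ofReal ((1 - p) / p) → ∑' a, weight b p a = 1) ∧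
      (lowerSlope b = ENNReal.ofReal ((1 - p) / p) →
        (fun n : ℕ => |(b n : ℝ) - (1 - p) / p * n|) =O[atTop] (fun n : ℕ => √(n : ℝ)) →
        ∑' a, weight b p a = 1) ∧
      (ENNReal.ofReal ((1 - p) / p) < lowerSlope b → ∑' a, weight b p a ≠ 1) := by
  have hsum := hasSum_weight ⟨p, Set.Ioo_subset_Icc_self hp⟩ hb
  have := cond_isProbabilityMeasure
    (walkLaw_stepsRight_ne_zero ⟨p, Set.Ioo_subset_Icc_self hp⟩ hp.1 b)
  rw [hsum.tsum_eq]
  exact ⟨hsum, measureReal_le_one,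
    fun h => cond_real_hitsBarrier_eq_one hp.1 (ae_hitsBarrier_of_lowerSlope_lt hp.1 h),
    fun _ h => cond_real_hitsBarrier_eq_one hp.1 (ae_hitsBarrier_of_isBigO hb hp.1 hp.2 h),
    fun h => cond_real_hitsBarrier_ne_one hp.1
      (walkLaw_stepsRight_diff_hitsBarrier_ne_zero hp.1 h)⟩
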